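/- Let $p\ge 1$ and $n\ge 0$ be integers, let $\langle\cdot,\cdot\rangle$ be the dot product on $\mathbb{R}^p$ and $S^{p-1}=\{\xi\in\mathbb{R}^p : |\xi|=1\}$. A spherical harmonic of degree $n$ is a function $Y_n:S^{p-1}\to\mathbb{R}$ that is the restriction to $S^{p-1}$ of a real homogeneous polynomial $H_n$ of degree $n$ in $p$ variables (the zero polynomial being allowed) with $\sum_{i=1}^p \partial^2 H_n/\partial x_i^2=0$. Let $N(p,n)$ be the maximal number of linearly independent harmonic homogeneous polynomials of degree $n$ in $p$ variables. Let $P_n$ be the Legendre polynomial of degree $n$ in dimension $p$: with $\eta=(1,0,\dots,0)$, it is the polynomial in one variable such that $L_n(\xi)=P_n(\langle\xi,\eta\rangle)$ for all $\xi\in S^{p-1}$, where $L_n$ is the unique harmonic homogeneous polynomial of degree $n$ in $p$ variables with $L_n(\eta)=1$ and $L_n(Rx)=L_n(x)$ for all $x\in\mathbb{R}^p$ and all orthogonal matrices $R$ with $R\eta=\eta$. (For $p\geq 2$ this determines $P_n$. For $p=1$ and $n\le 1$ it determines the values $P_n(\pm1)$, which are the only ones used below; for $p=1$ and $n\ge2$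 we have $N(p,n)=0$, and no $P_n$ is needed.) Theorem. For every spherical harmonic $Y_n$ of degree $n$ there exist real coefficients $a_k$ and unit vectors $\eta_k\in S^{p-1}$, $1\le k\le N(p,n)$, such that $$Y_n(\xi)=\sum_{k=1}^{N(p,n)} a_k\,P_n(\langle\xi,\eta_k\rangle)\qquad\text{for all }\xi\in S^{p-1}.$$ -/

import Mathlib

noncomputable section

/-- The Laplace operator `∑ i, ∂² / ∂ x_i²` on real polynomials in `p` variables. -/
def polyLaplacian (p : ℕ) : MvPolynomial (Fin p) ℝ →ₗ[ℝ] MvPolynomial (Fin p) ℝ :=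
  ∑ i : Fin p, (MvPolynomial.pderiv i).toLinearMap ∘ₗ (MvPolynomial.pderiv i).toLinearMap

/-- The real vector space of harmonic homogeneous polynomials of degree `n` in `p` variables
(the zero polynomial included). -/
def harmonicHomogeneous (p n : ℕ) : Submodule ℝ (MvPolynomial (Fin p) ℝ) :=
  MvPolynomial.homogeneousSubmodule (Fin p) ℝ n ⊓ LinearMap.ker (polyLaplacian p)

/-- `N(p, n)`: the (maximal) number of linearly independent harmonic homogeneous polynomials of
degree `n` in `p` variables. -/
def numHarmonic (p n : ℕ) : ℕ :=
  Module.finrank ℝ (harmonicHomogeneous p n)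

/-- The unit sphere `S^{p-1}` of `ℝ^p`, for the Euclidean norm. -/
abbrev UnitSphere (p : ℕ) : Type :=
  Metric.sphere (0 : EuclideanSpace ℝ (Fin p)) 1

/-- `Y : S^{p-1} → ℝ` is a spherical harmonic of degree `n`: the restriction to the unit sphere of
a harmonic homogeneous polynomial of degree `n`. -/
def IsSphericalHarmonic (p n : ℕ) (Y : UnitSphere p → ℝ) : Prop :=
  ∃ H ∈ harmonicHomogeneous p n,
    ∀ ξ : UnitSphere p, Y ξ = MvPolynomial.eval (ξ : EuclideanSpace ℝ (Fin p)).ofLp H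

/-- With `η = (1, 0, …, 0)`: `L` is a harmonic homogeneous polynomial of degree `n` with
`L(η) = 1` and `L(R x) = L(x)` for all orthogonal matrices `R` such that `R η = η`. -/
def IsZonalHarmonic (p n : ℕ) [NeZero p] (L : MvPolynomial (Fin p) ℝ) : Prop :=
  L ∈ harmonicHomogeneous p n ∧
  MvPolynomial.eval (Pi.single 0 1) L = 1 ∧
  ∀ R ∈ Matrix.orthogonalGroup (Fin p) ℝ,
    R.mulVec (Pi.single 0 1) = Pi.single 0 1 →
      ∀ x : Fin p → ℝ, MvPolynomial.eval (R.mulVec x) L = MvPolynomial.eval x L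

/-- `P` is a Legendre polynomial of degree `n` in dimension `p`: it writes the zonal harmonic `L`
on the unit sphere in terms of `t = ⟨ξ, η⟩`, where `η = (1, 0, …, 0)`. -/
def IsLegendrePolynomial (p n : ℕ) [NeZero p] (P : Polynomial ℝ) : Prop :=
  ∃ L : MvPolynomial (Fin p) ℝ, IsZonalHarmonic p n L ∧
    ∀ ξ : UnitSphere p,
      MvPolynomial.eval (ξ : EuclideanSpace ℝ (Fin p)).ofLp L =
        P.eval (inner ℝ (ξ : EuclideanSpace ℝ (Fin p)) (EuclideanSpace.single 0 1))

open Classical in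
/-- The Legendre polynomial `P_n` of degree `n` in dimension `p`. It exists and is unique for
`2 ≤ p`. For `p = 1` and `n ≤ 1` it exists and its values at `±1` are unique; for `p = 1` and
`2 ≤ n` there is none (the only harmonic homogeneous polynomial is `0`), and `0` is a dummy. -/
def legendrePolynomial (p n : ℕ) [NeZero p] : Polynomial ℝ :=
  if h : ∃ P : Polynomial ℝ, IsLegendrePolynomial p n P then h.choose else 0

end

/-!
The harmonic homogeneous polynomials of degree `n` are spanned by the zonal ones, and a spanning set
contains a basis, which has `N(p, n)` elements.

The spanning property rests on the Fischer form `⟨P, Q⟩ = ∑ α, α! * P_α * Q_α`, which is positive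
definite. For it, multiplication by `x_i` is adjoint to `∂ / ∂ x_i`, so multiplication by `|x|²` is
adjoint to the Laplace operator (`fischer_normSqPoly_mul`), and `⟨η, x⟩ ^ n` pairs with a homogeneous
`Q` of degree `n` to `n! * Q(η)` (`fischer_linForm_pow`). For a unit vector `η`, an explicit
combination `zonalPoly n η` of the `⟨η, x⟩ ^ (n - 2 * k) * |x| ^ (2 * k)` is harmonic
(`zonalPoly_mem`). It is congruent to `⟨η, x⟩ ^ n` modulo `|x|²`, hence it also pairs with a harmonic
`Q` to `n! * Q(η)` (`fischer_zonalPoly`). A harmonic `Q` orthogonal to all zonal polynomials thus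
vanishes on the sphere, so is zero (`span_zonalPoly`).

It remains to see that the Legendre polynomial exists and that `P_n(⟨ξ, η⟩)` is a non-zero multiple
of `zonalPoly n η` on the sphere. If some harmonic `Q ≠ 0` exists, then `zonalPoly n η ≠ 0` wherever
`Q(η) ≠ 0`; its pairing with itself is `n!` times its value at the pole, which is therefore
non-zero, and one can normalize (`exists_isLegendrePolynomial`). Conversely, a harmonic `L` that is a
function of `ξ_0` on the sphere is a polynomial in `x_0` and `|x|² - x_0²`, so it is congruent to
some `β * x_0 ^ n` modulo `|x|²`. Then `L - β * zonalPoly n e_0` is a harmonic multiple of `|x|²`,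
which is orthogonal to itself, so it is zero (`exists_eq_smul_zonalPoly`). A reflection carries the
pole `e_0` to an arbitrary `η`.
-/

open MvPolynomial

/-! ### The Fischer form -/

/-- The Fischer (apolar) bilinear form on real polynomials, `(P, Q) ↦ ∑ α, α! * P_α * Q_α`, that is
`P(∂) Q` evaluated at `0`. -/
noncomputable def fischer (p : ℕ) :
    MvPolynomial (Fin p) ℝ →ₗ[ℝ] MvPolynomial (Fin p) ℝ →ₗ[ℝ] ℝ :=
  (basisMonomials (Fin p) ℝ).constr ℝ fun α => ((∏ i, (α i).factorial : ℕ) : ℝ) • lcoeff ℝ α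

lemma fischer_monomial {p : ℕ} (α : Fin p →₀ ℕ) (Q : MvPolynomial (Fin p) ℝ) :
    fischer p (monomial α 1) Q = ((∏ i, (α i).factorial : ℕ) : ℝ) * coeff α Q := by
  have := (basisMonomials (Fin p) ℝ).constr_basis ℝ
    (fun α => ((∏ i, (α i).factorial : ℕ) : ℝ) • lcoeff ℝ α) α
  rw [coe_basisMonomials] at this
  rw [fischer, this]
  simp [lcoeff]

lemma fischer_apply {p : ℕ} (P Q : MvPolynomial (Fin p) ℝ) :
    fischer p P Q =
      ∑ α ∈ P.support, ((∏ i, (α i).factorial : ℕ) : ℝ) * (coeff α P * coeff α Q) := by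
  conv_lhs => rw [P.as_sum]
  rw [map_sum, LinearMap.sum_apply]
  refine Finset.sum_congr rfl fun α _ => ?_
  have : monomial α (coeff α P) = coeff α P • monomial α (1 : ℝ) := by
    rw [smul_monomial, smul_eq_mul, mul_one]
  rw [this, map_smul, LinearMap.smul_apply, fischer_monomial, smul_eq_mul]
  ring

lemma eq_zero_of_fischer_self {p : ℕ} {P : MvPolynomial (Fin p) ℝ} (h : fischer p P P = 0) :
    P = 0 := by
  rw [fischer_apply, Finset.sum_eq_zero_iff_of_nonneg
    (fun α _ => mul_nonneg (Nat.cast_nonneg _) (mul_self_nonneg _))] at h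
  ext α
  by_contra hα
  have h1 := h α (mem_support_iff.2 hα)
  have h2 : ((∏ i, (α i).factorial : ℕ) : ℝ) ≠ 0 :=
    Nat.cast_ne_zero.2 (Finset.prod_ne_zero_iff.2 fun i _ => Nat.factorial_ne_zero _)
  simp_all

/-- Multiplication by `x_i` is adjoint to `∂ / ∂ x_i`. -/
lemma fischer_X_mul {p : ℕ} (i : Fin p) (P Q : MvPolynomial (Fin p) ℝ) :
    fischer p (X i * P) Q = fischer p P (pderiv i Q) := by
  induction P using MvPolynomial.induction_on' with
  | add P₁ P₂ h₁ h₂ => rw [mul_add, map_add, map_add, LinearMap.add_apply, LinearMap.add_apply,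
      h₁, h₂]
  | monomial α a =>
    have ha : monomial α a = a • monomial α (1 : ℝ) := by rw [smul_monomial, smul_eq_mul, mul_one]
    rw [ha, mul_smul_comm, map_smul, map_smul, LinearMap.smul_apply, LinearMap.smul_apply]
    congr 1
    have hX : X i * monomial α (1 : ℝ) = monomial (α + Finsupp.single i 1) 1 := by
      rw [X, monomial_mul, one_mul, add_comm]
    rw [hX, fischer_monomial, fischer_monomial, coeff_pderiv]
    have hfac : (∏ j, ((α + Finsupp.single i 1 : Fin p →₀ ℕ) j).factorial)
        = (∏ j, (α j).factorial) * (α i + 1) := by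
      rw [← Finset.mul_prod_erase _ _ (Finset.mem_univ i),
        ← Finset.mul_prod_erase _ (fun j => (α j).factorial) (Finset.mem_univ i)]
      have : ∏ j ∈ Finset.univ.erase i, ((α + Finsupp.single i 1 : Fin p →₀ ℕ) j).factorial
          = ∏ j ∈ Finset.univ.erase i, (α j).factorial := by
        refine Finset.prod_congr rfl fun j hj => ?_
        have hji : i ≠ j := (Finset.ne_of_mem_erase hj).symm
        simp [hji]
      rw [this]
      simp only [Finsupp.add_apply, Finsupp.single_eq_same, Nat.factorial_succ]
      ring
    rw [hfac]
    push_cast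
    ring

/-- The polynomial `|x|² = ∑ i, x_i²`. -/
noncomputable def normSqPoly (p : ℕ) : MvPolynomial (Fin p) ℝ := ∑ i, X i ^ 2

/-- The linear form `⟨η, x⟩ = ∑ i, η_i x_i`. -/
noncomputable def linForm {p : ℕ} (η : Fin p → ℝ) : MvPolynomial (Fin p) ℝ := ∑ i, C (η i) * X i

lemma eval_normSqPoly {p : ℕ} (x : Fin p → ℝ) : eval x (normSqPoly p) = ∑ i, x i ^ 2 := by
  simp [normSqPoly]

lemma eval_linForm {p : ℕ} (η x : Fin p → ℝ) : eval x (linForm η) = ∑ i, η i * x i := by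
  simp [linForm]

lemma isHomogeneous_normSqPoly (p : ℕ) : (normSqPoly p).IsHomogeneous 2 :=
  IsHomogeneous.sum _ _ _ fun i _ => isHomogeneous_X_pow i 2

lemma isHomogeneous_linForm {p : ℕ} (η : Fin p → ℝ) : (linForm η).IsHomogeneous 1 :=
  IsHomogeneous.sum _ _ _ fun i _ => isHomogeneous_C_mul_X _ i

lemma polyLaplacian_apply {p : ℕ} (P : MvPolynomial (Fin p) ℝ) :
    polyLaplacian p P = ∑ i, pderiv i (pderiv i P) := by
  simp [polyLaplacian]

/-- Multiplication by `|x|²` is adjoint to the Laplace operator. -/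
lemma fischer_normSqPoly_mul {p : ℕ} (P Q : MvPolynomial (Fin p) ℝ) :
    fischer p (normSqPoly p * P) Q = fischer p P (polyLaplacian p Q) := by
  rw [normSqPoly, Finset.sum_mul, map_sum, LinearMap.sum_apply, polyLaplacian_apply, map_sum]
  refine Finset.sum_congr rfl fun i _ => ?_
  rw [pow_two, mul_assoc, fischer_X_mul, fischer_X_mul]

/-- The powers of linear forms reproduce homogeneous polynomials under the Fischer form. -/
lemma fischer_linForm_pow {p : ℕ} (η : Fin p → ℝ) (n : ℕ) {Q : MvPolynomial (Fin p) ℝ}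
    (hQ : Q.IsHomogeneous n) : fischer p (linForm η ^ n) Q = n.factorial * eval η Q := by
  induction n generalizing Q with
  | zero =>
    rw [← totalDegree_zero_iff_isHomogeneous, totalDegree_eq_zero_iff_eq_C] at hQ
    have h1 : (linForm η ^ 0 : MvPolynomial (Fin p) ℝ) = monomial 0 1 := by simp
    rw [h1, fischer_monomial, hQ]
    simp
  | succ n ih =>
    have h := congrArg (eval η) hQ.sum_X_mul_pderiv
    rw [map_sum] at h
    simp only [map_mul, eval_X, nsmul_eq_mul, map_natCast] at h
    rw [pow_succ', linForm, Finset.sum_mul, map_sum, LinearMap.sum_apply, ← linForm]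
    have h2 : ∀ i, fischer p (C (η i) * X i * linForm η ^ n) Q
        = n.factorial * (η i * eval η (pderiv i Q)) := by
      intro i
      rw [mul_assoc, ← smul_eq_C_mul, map_smul, LinearMap.smul_apply, fischer_X_mul,
        ih (by simpa using hQ.pderiv (i := i)), smul_eq_mul]
      ring
    rw [Finset.sum_congr rfl fun i _ => h2 i, ← Finset.mul_sum, h, Nat.factorial_succ]
    push_cast
    ring

/-! ### Zonal harmonics -/

lemma C_ofNat_real {p m : ℕ} [m.AtLeastTwo] :
    (C (ofNat(m) : ℝ) : MvPolynomial (Fin p) ℝ) = ofNat(m) :=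
  map_ofNat C m

lemma pderiv_linForm {p : ℕ} (η : Fin p → ℝ) (i : Fin p) : pderiv i (linForm η) = C (η i) := by
  simp [linForm, pderiv_X, Pi.single_apply]

lemma pderiv_normSqPoly {p : ℕ} (i : Fin p) : pderiv i (normSqPoly p) = 2 * X i := by
  simp [normSqPoly, pderiv_X, Pi.single_apply]

lemma polyLaplacian_mul {p : ℕ} (P Q : MvPolynomial (Fin p) ℝ) :
    polyLaplacian p (P * Q) =
      polyLaplacian p P * Q + 2 * ∑ i, pderiv i P * pderiv i Q + P * polyLaplacian p Q := by
  simp only [polyLaplacian_apply, pderiv_mul, map_add, Finset.sum_add_distrib, Finset.sum_mul,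
    Finset.mul_sum]
  rw [← sub_eq_zero]
  simp only [← Finset.sum_add_distrib, ← Finset.sum_sub_distrib]
  exact Finset.sum_eq_zero fun i _ => by ring

lemma polyLaplacian_linForm_pow {p : ℕ} {η : Fin p → ℝ} (hη : ∑ i, η i ^ 2 = 1) (m : ℕ) :
    polyLaplacian p (linForm η ^ m) = C ((m : ℝ) * (m - 1)) * linForm η ^ (m - 2) := by
  have h1 : ∀ i, pderiv i (pderiv i (linForm η ^ m)) =
      C ((m : ℝ) * (m - 1)) * linForm η ^ (m - 2) * C (η i ^ 2) := by
    intro i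
    rw [pderiv_pow, pderiv_linForm, pderiv_mul, pderiv_C, mul_zero, add_zero, pderiv_mul,
      pderiv_pow, pderiv_linForm]
    rcases m with _ | m
    · simp
    · simp
      ring
  rw [polyLaplacian_apply, Finset.sum_congr rfl fun i _ => h1 i, ← Finset.mul_sum, ← map_sum, hη,
    map_one, mul_one]

lemma polyLaplacian_normSqPoly_pow (p k : ℕ) :
    polyLaplacian p (normSqPoly p ^ k) =
      C (2 * (k : ℝ) * (2 * k + p - 2)) * normSqPoly p ^ (k - 1) := by
  have h1 : ∀ i, pderiv i (pderiv i (normSqPoly p ^ k)) =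
      C (4 * (k : ℝ) * (k - 1)) * normSqPoly p ^ (k - 2) * X i ^ 2
        + C (2 * (k : ℝ)) * normSqPoly p ^ (k - 1) := by
    intro i
    rw [pderiv_pow, pderiv_normSqPoly]
    rcases k with _ | k
    · simp
    · have h2 : pderiv i (2 : MvPolynomial (Fin p) ℝ) = 0 := by rw [← C_ofNat_real, pderiv_C]
      rw [pderiv_mul, pderiv_mul, pderiv_mul, pderiv_pow, pderiv_normSqPoly, h2]
      simp [C_ofNat_real]
      ring
  rw [polyLaplacian_apply, Finset.sum_congr rfl fun i _ => h1 i, Finset.sum_add_distrib,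
    ← Finset.mul_sum, ← normSqPoly, Finset.sum_const, Finset.card_univ, Fintype.card_fin]
  rcases k with _ | _ | k
  · simp
  · simp [C_ofNat_real]
    ring
  · simp [C_ofNat_real]
    ring

lemma sum_pderiv_linForm_pow_mul {p : ℕ} (η : Fin p → ℝ) (m k : ℕ) :
    ∑ i, pderiv i (linForm η ^ m) * pderiv i (normSqPoly p ^ k) =
      C (2 * (k : ℝ) * m) * (linForm η ^ m * normSqPoly p ^ (k - 1)) := by
  have h1 : ∀ i, pderiv i (linForm η ^ m) * pderiv i (normSqPoly p ^ k) =
      C (2 * (k : ℝ) * m) * linForm η ^ (m - 1) * normSqPoly p ^ (k - 1) * (C (η i) * X i) := by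
    intro i
    rw [pderiv_pow, pderiv_pow, pderiv_linForm, pderiv_normSqPoly]
    simp [C_ofNat_real]
    ring
  rw [Finset.sum_congr rfl fun i _ => h1 i, ← Finset.mul_sum, ← linForm]
  rcases m with _ | m
  · simp
  · simp
    ring

/-- The action of the Laplace operator on `⟨η, x⟩ ^ m * |x| ^ (2 * k)`, for `|η| = 1`. Truncated
exponents occur only where the coefficient vanishes. -/
lemma polyLaplacian_linForm_pow_mul_normSqPoly_pow {p : ℕ} {η : Fin p → ℝ}
    (hη : ∑ i, η i ^ 2 = 1) (m k : ℕ) :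
    polyLaplacian p (linForm η ^ m * normSqPoly p ^ k) =
      C ((m : ℝ) * (m - 1)) * (linForm η ^ (m - 2) * normSqPoly p ^ k) +
      C (2 * (k : ℝ) * (2 * k + p - 2 + 2 * m)) * (linForm η ^ m * normSqPoly p ^ (k - 1)) := by
  rw [polyLaplacian_mul, sum_pderiv_linForm_pow_mul, polyLaplacian_normSqPoly_pow,
    polyLaplacian_linForm_pow hη]
  simp [C_ofNat_real]
  ring

/-- The coefficient of `⟨η, x⟩ ^ (n - 2 * k) * |x| ^ (2 * k)` in the zonal harmonic of degree `n`,
normalized to `1` for `k = 0`. The recursion is the vanishing of the Laplacian. -/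
noncomputable def zonalCoeff (p n : ℕ) : ℕ → ℝ
  | 0 => 1
  | k + 1 => -(((n : ℝ) - 2 * k) * (n - 2 * k - 1) / (2 * (k + 1) * (2 * n - 2 * k + p - 4))) *
      zonalCoeff p n k

/-- The harmonic homogeneous polynomial of degree `n` which is a combination of the
`⟨η, x⟩ ^ (n - 2 * k) * |x| ^ (2 * k)`, with coefficient `1` at `⟨η, x⟩ ^ n`. -/
noncomputable def zonalPoly {p : ℕ} (n : ℕ) (η : Fin p → ℝ) : MvPolynomial (Fin p) ℝ :=
  ∑ k ∈ Finset.range (n / 2 + 1),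
    C (zonalCoeff p n k) * (linForm η ^ (n - 2 * k) * normSqPoly p ^ k)

lemma isHomogeneous_linForm_pow_mul_normSqPoly_pow {p n k : ℕ} (η : Fin p → ℝ)
    (hk : 2 * k ≤ n) : (linForm η ^ (n - 2 * k) * normSqPoly p ^ k).IsHomogeneous n := by
  have := ((isHomogeneous_linForm η).pow (n - 2 * k)).mul ((isHomogeneous_normSqPoly p).pow k)
  rwa [one_mul, Nat.sub_add_cancel hk] at this

lemma zonalPoly_mem {p n : ℕ} [NeZero p] {η : Fin p → ℝ} (hη : ∑ i, η i ^ 2 = 1) :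
    zonalPoly n η ∈ harmonicHomogeneous p n := by
  refine ⟨?_, ?_⟩
  · refine IsHomogeneous.sum _ _ _ fun k hk => IsHomogeneous.C_mul ?_ _
    exact isHomogeneous_linForm_pow_mul_normSqPoly_pow η (by rw [Finset.mem_range] at hk; omega)
  · rw [SetLike.mem_coe, LinearMap.mem_ker, zonalPoly, map_sum]
    have h1 : ∀ k, polyLaplacian p
          (C (zonalCoeff p n k) * (linForm η ^ (n - 2 * k) * normSqPoly p ^ k)) =
        C (zonalCoeff p n k) *
          (C (((n - 2 * k : ℕ) : ℝ) * ((n - 2 * k : ℕ) - 1)) *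
              (linForm η ^ (n - 2 * k - 2) * normSqPoly p ^ k)) +
        C (zonalCoeff p n k) *
            (C (2 * (k : ℝ) * (2 * k + p - 2 + 2 * (n - 2 * k : ℕ))) *
              (linForm η ^ (n - 2 * k) * normSqPoly p ^ (k - 1))) := by
      intro k
      rw [← smul_eq_C_mul, map_smul, polyLaplacian_linForm_pow_mul_normSqPoly_pow hη, smul_eq_C_mul,
        mul_add]
    rw [Finset.sum_congr rfl fun k _ => h1 k, Finset.sum_add_distrib]
    -- the second sum, shifted by one, cancels the first up to its last term, which is zero
    rw [Finset.sum_range_succ, Finset.sum_range_succ' (fun k => C (zonalCoeff p n k) *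
      (C (2 * (k : ℝ) * (2 * k + p - 2 + 2 * (n - 2 * k : ℕ))) *
              (linForm η ^ (n - 2 * k) * normSqPoly p ^ (k - 1))))]
    have hlast : ((n - 2 * (n / 2) : ℕ) : ℝ) * ((n - 2 * (n / 2) : ℕ) - 1) = 0 := by
      have : n - 2 * (n / 2) = 0 ∨ n - 2 * (n / 2) = 1 := by omega
      rcases this with h | h <;> rw [h] <;> simp
    rw [hlast, map_zero, zero_mul, mul_zero, add_zero, Nat.cast_zero, mul_zero, zero_mul, map_zero,
      zero_mul, mul_zero, add_zero, ← Finset.sum_add_distrib]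
    refine Finset.sum_eq_zero fun k hk => ?_
    rw [Finset.mem_range] at hk
    have hk' : 2 * (k + 1) ≤ n := by omega
    have e1 : ((n - 2 * k : ℕ) : ℝ) = n - 2 * k := by
      rw [Nat.cast_sub (by omega)]; push_cast; ring
    have e2 : ((n - 2 * (k + 1) : ℕ) : ℝ) = n - 2 * k - 2 := by
      rw [Nat.cast_sub hk']; push_cast; ring
    have e3 : n - 2 * k - 2 = n - 2 * (k + 1) := by omega
    rw [e1, e2, e3, Nat.add_sub_cancel, ← mul_assoc (C _) (C _), ← mul_assoc (C _) (C _),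
      ← C_mul, ← C_mul, ← add_mul,
      ← C_add]
    have hden : (2 * (n : ℝ) - 2 * k + p - 4) ≠ 0 := by
      have h1 : (2 : ℝ) * (k + 1) ≤ n := by exact_mod_cast hk'
      have h2 : (1 : ℝ) ≤ p := by exact_mod_cast Nat.one_le_iff_ne_zero.2 (NeZero.ne p)
      have h3 : (0 : ℝ) ≤ k := Nat.cast_nonneg k
      intro h
      linarith
    have hk1 : (k : ℝ) + 1 ≠ 0 := by positivity
    have hz : zonalCoeff p n k * (((n : ℝ) - 2 * k) * (n - 2 * k - 1)) +
        zonalCoeff p n (k + 1) *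
          (2 * ((k + 1 : ℕ) : ℝ) * (2 * ((k + 1 : ℕ) : ℝ) + p - 2 + 2 * (n - 2 * k - 2))) = 0 := by
      have h4 : 2 * ((k + 1 : ℕ) : ℝ) + p - 2 + 2 * ((n : ℝ) - 2 * k - 2)
          = 2 * n - 2 * k + p - 4 := by push_cast; ring
      rw [h4, zonalCoeff, Nat.cast_succ]
      generalize 2 * (n : ℝ) - 2 * k + p - 4 = D at hden
      field_simp
      ring
    rw [hz, map_zero, zero_mul]

lemma normSqPoly_dvd_zonalPoly_sub {p : ℕ} (n : ℕ) (η : Fin p → ℝ) :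
    normSqPoly p ∣ zonalPoly n η - linForm η ^ n := by
  have h : zonalPoly n η - linForm η ^ n = ∑ k ∈ Finset.range (n / 2),
      C (zonalCoeff p n (k + 1)) * (linForm η ^ (n - 2 * (k + 1)) * normSqPoly p ^ (k + 1)) := by
    rw [zonalPoly, Finset.sum_range_succ']
    simp [zonalCoeff]
  rw [h]
  exact Finset.dvd_sum fun k _ => ((dvd_pow_self _ k.succ_ne_zero).mul_left _).mul_left _

/-- Multiples of `|x|²` are orthogonal to harmonic polynomials. -/
lemma fischer_eq_zero_of_normSqPoly_dvd {p : ℕ} {P Q : MvPolynomial (Fin p) ℝ}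
    (h : normSqPoly p ∣ P) (hQ : polyLaplacian p Q = 0) : fischer p P Q = 0 := by
  obtain ⟨G, rfl⟩ := h
  rw [fischer_normSqPoly_mul, hQ, map_zero]

/-- Up to the factor `n!`, the zonal polynomials are the reproducing kernel of the harmonic
homogeneous polynomials. -/
lemma fischer_zonalPoly {p n : ℕ} (η : Fin p → ℝ) {Q : MvPolynomial (Fin p) ℝ}
    (hQ : Q ∈ harmonicHomogeneous p n) :
    fischer p (zonalPoly n η) Q = n.factorial * eval η Q := by
  have := fischer_eq_zero_of_normSqPoly_dvd (normSqPoly_dvd_zonalPoly_sub n η) hQ.2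
  rw [map_sub, LinearMap.sub_apply, sub_eq_zero] at this
  rw [this, fischer_linForm_pow η n hQ.1]

lemma eval_smul_of_isHomogeneous {p n : ℕ} {Q : MvPolynomial (Fin p) ℝ} (hQ : Q.IsHomogeneous n)
    (c : ℝ) (x : Fin p → ℝ) : eval (c • x) Q = c ^ n * eval x Q := by
  rw [eval_eq, eval_eq, Finset.mul_sum]
  refine Finset.sum_congr rfl fun α hα => ?_
  simp only [Pi.smul_apply, smul_eq_mul, mul_pow, Finset.prod_mul_distrib]
  have h : ∑ i ∈ α.support, α i = n := by
    have := hQ.degree_eq_sum_deg_support hα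
    exact this.symm
  rw [Finset.prod_pow_eq_pow_sum, h]
  ring

lemma sum_sq_smul_inv_sqrt {p : ℕ} {x : Fin p → ℝ} (hx : x ≠ 0) :
    0 < √(∑ i, x i ^ 2) ∧ ∑ i, ((√(∑ i, x i ^ 2))⁻¹ • x) i ^ 2 = 1 := by
  have h0 : 0 < ∑ i, x i ^ 2 := by
    obtain ⟨i, hi⟩ := Function.ne_iff.1 hx
    exact Finset.sum_pos' (fun i _ => sq_nonneg _) ⟨i, Finset.mem_univ i, by
      simp only [Pi.zero_apply] at hi; positivity⟩
  refine ⟨Real.sqrt_pos.2 h0, ?_⟩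
  simp only [Pi.smul_apply, smul_eq_mul, mul_pow, ← Finset.mul_sum]
  rw [inv_pow, Real.sq_sqrt h0.le, inv_mul_cancel₀ h0.ne']

/-- A homogeneous polynomial vanishing on the unit sphere is zero. -/
lemma eq_zero_of_eval_sphere {p n : ℕ} [NeZero p] {Q : MvPolynomial (Fin p) ℝ}
    (hQ : Q.IsHomogeneous n) (h : ∀ x : Fin p → ℝ, ∑ i, x i ^ 2 = 1 → eval x Q = 0) : Q = 0 := by
  have h1 : ∀ x : Fin p → ℝ, x ≠ 0 → eval x Q = 0 := by
    intro x hx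
    obtain ⟨hs, h1⟩ := sum_sq_smul_inv_sqrt hx
    have := h _ h1
    rw [eval_smul_of_isHomogeneous hQ] at this
    exact (mul_eq_zero.1 this).resolve_left (pow_ne_zero _ (inv_pos.2 hs).ne')
  -- `X 0 * Q` vanishes at the origin too
  have h2 : X 0 * Q = 0 := by
    refine MvPolynomial.funext fun x => ?_
    rcases eq_or_ne x 0 with rfl | hx
    · simp
    · simp [h1 x hx]
  exact (mul_eq_zero.1 h2).resolve_left (X_ne_zero 0)

instance finite_harmonicHomogeneous (p n : ℕ) : Module.Finite ℝ (harmonicHomogeneous p n) := by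
  have : Module.Finite ℝ (homogeneousSubmodule (Fin p) ℝ n) :=
    Module.Finite.iff_fg.2 (homogeneousSubmodule_fg _ _ n)
  exact Submodule.finiteDimensional_of_le inf_le_left

/-- A subset `S` of a finite-dimensional space `H` spans `H` if only `0` is orthogonal to `S` for an
anisotropic form: every functional on `H` that vanishes on `S` is of the form `B · Q`. -/
lemma span_eq_of_forall_orthogonal_eq_zero {V : Type*} [AddCommGroup V] [Module ℝ V]
    (B : V →ₗ[ℝ] V →ₗ[ℝ] ℝ) (hB : ∀ v, B v v = 0 → v = 0) (H : Submodule ℝ V)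
    [Module.Finite ℝ H] {S : Set V} (hS : S ⊆ H)
    (h : ∀ Q ∈ H, (∀ s ∈ S, B s Q = 0) → Q = 0) : Submodule.span ℝ S = H := by
  refine le_antisymm (Submodule.span_le.2 hS) ?_
  by_contra hlt
  have hW : (Submodule.span ℝ S).comap H.subtype < ⊤ := by
    rw [lt_top_iff_ne_top]
    exact fun h => hlt (Submodule.comap_subtype_eq_top.1 h)
  obtain ⟨f, hf, hfW⟩ := Submodule.exists_le_ker_of_lt_top _ hW
  let T : H →ₗ[ℝ] Module.Dual ℝ H := B.flip.domRestrict₁₂ H H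
  have hT : Function.Injective T := by
    rw [← LinearMap.ker_eq_bot, LinearMap.ker_eq_bot']
    exact fun Q hQ => Subtype.ext (hB Q (LinearMap.congr_fun hQ Q))
  obtain ⟨Q, rfl⟩ := (LinearMap.injective_iff_surjective_of_finrank_eq_finrank
      Subspace.dual_finrank_eq.symm).1 hT f
  have hQ : Q = 0 := Subtype.ext <| h Q Q.2 fun s hs =>
    hfW (show (⟨s, hS hs⟩ : H) ∈ (Submodule.span ℝ S).comap H.subtype from
      Submodule.subset_span hs)
  exact hf (by rw [hQ, map_zero])

/-- The zonal polynomials with unit vectors as poles span the harmonic homogeneous polynomials: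
a harmonic polynomial that is orthogonal to all of them vanishes on the sphere. -/
lemma span_zonalPoly (p n : ℕ) [NeZero p] :
    Submodule.span ℝ {Q | ∃ η : Fin p → ℝ, ∑ i, η i ^ 2 = 1 ∧ zonalPoly n η = Q} =
      harmonicHomogeneous p n := by
  refine span_eq_of_forall_orthogonal_eq_zero (fischer p) (fun _ => eq_zero_of_fischer_self) _
    ?_ fun Q hQ h => ?_
  · rintro _ ⟨η, hη, rfl⟩
    exact zonalPoly_mem hη
  · refine eq_zero_of_eval_sphere hQ.1 fun η hη => ?_
    have h1 := h _ ⟨η, hη, rfl⟩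
    rw [fischer_zonalPoly η hQ] at h1
    exact (mul_eq_zero.1 h1).resolve_left (Nat.cast_ne_zero.2 n.factorial_ne_zero)

/-! ### The Legendre polynomial -/

/-- The polynomial in one variable that represents `zonalPoly n η` on the unit sphere as a function
of `⟨ξ, η⟩`: an unnormalized form of the Legendre polynomial. -/
noncomputable def zonalProfile (p n : ℕ) : Polynomial ℝ :=
  ∑ k ∈ Finset.range (n / 2 + 1), Polynomial.C (zonalCoeff p n k) * Polynomial.X ^ (n - 2 * k)

lemma eval_zonalPoly {p : ℕ} (n : ℕ) (η : Fin p → ℝ) (x : Fin p → ℝ) :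
    eval x (zonalPoly n η) = ∑ k ∈ Finset.range (n / 2 + 1),
      zonalCoeff p n k * ((∑ i, η i * x i) ^ (n - 2 * k) * (∑ i, x i ^ 2) ^ k) := by
  simp [zonalPoly, eval_linForm, eval_normSqPoly]

lemma eval_zonalPoly_of_sphere {p : ℕ} (n : ℕ) (η : Fin p → ℝ) {x : Fin p → ℝ}
    (hx : ∑ i, x i ^ 2 = 1) :
    eval x (zonalPoly n η) = (zonalProfile p n).eval (∑ i, η i * x i) := by
  rw [eval_zonalPoly, hx, zonalProfile, Polynomial.eval_finsetSum]
  simp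

lemma zonalPoly_eq_zero_of_eval {p n : ℕ} [NeZero p] {η : Fin p → ℝ} (hη : ∑ i, η i ^ 2 = 1)
    (h : eval η (zonalPoly n η) = 0) : zonalPoly n η = 0 :=
  eq_zero_of_fischer_self (by rw [fischer_zonalPoly η (zonalPoly_mem hη), h, mul_zero])

/-- The value of a zonal polynomial at its pole is the same for all poles; it is non-zero as soon as
there is a non-zero harmonic polynomial, by the reproducing property. -/
lemma zonalProfile_eval_one_ne_zero {p n : ℕ} [NeZero p] (h : harmonicHomogeneous p n ≠ ⊥) :
    (zonalProfile p n).eval 1 ≠ 0 := by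
  obtain ⟨Q, hQ, hQ0⟩ := Submodule.exists_mem_ne_zero_of_ne_bot h
  intro h1
  refine hQ0 (eq_zero_of_eval_sphere hQ.1 fun η hη => ?_)
  have h2 : zonalPoly n η = 0 := by
    refine zonalPoly_eq_zero_of_eval hη ?_
    rw [eval_zonalPoly_of_sphere n η hη]
    simpa [← pow_two, hη] using h1
  have h3 := fischer_zonalPoly η hQ
  rw [h2, map_zero, LinearMap.zero_apply] at h3
  exact (mul_eq_zero.1 h3.symm).resolve_left (Nat.cast_ne_zero.2 n.factorial_ne_zero)

lemma sum_single_mul {p : ℕ} [NeZero p] (x : Fin p → ℝ) :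
    ∑ i, (Pi.single 0 1 : Fin p → ℝ) i * x i = x 0 := by
  simp [Pi.single_apply]

lemma sum_single_sq (p : ℕ) [NeZero p] : ∑ i, (Pi.single 0 1 : Fin p → ℝ) i ^ 2 = 1 := by
  simp [Pi.single_apply]

lemma dotProduct_mulVec_mulVec {p : ℕ} {R : Matrix (Fin p) (Fin p) ℝ}
    (hR : R ∈ Matrix.orthogonalGroup (Fin p) ℝ) (x y : Fin p → ℝ) :
    R.mulVec x ⬝ᵥ R.mulVec y = x ⬝ᵥ y := by
  rw [Matrix.dotProduct_mulVec, ← Matrix.mulVec_transpose, Matrix.mulVec_mulVec]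
  have : R.transpose * R = 1 := (Matrix.mem_orthogonalGroup_iff' _ _).1 hR
  rw [this, Matrix.one_mulVec]

lemma coe_sphere_sum_sq {p : ℕ} (ξ : UnitSphere p) :
    ∑ i, (ξ : EuclideanSpace ℝ (Fin p)).ofLp i ^ 2 = 1 := by
  have h := ξ.2
  rw [mem_sphere_zero_iff_norm] at h
  have h2 := EuclideanSpace.real_norm_sq_eq (ξ : EuclideanSpace ℝ (Fin p))
  rw [h, one_pow] at h2
  exact h2.symm

lemma inner_eq_sum_mul {p : ℕ} (ξ η : EuclideanSpace ℝ (Fin p)) :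
    inner ℝ ξ η = ∑ i, η.ofLp i * ξ.ofLp i := by
  simp [PiLp.inner_apply]

lemma isZonalHarmonic_zonalPoly {p n : ℕ} [NeZero p] (h : harmonicHomogeneous p n ≠ ⊥) :
    IsZonalHarmonic p n
      (((zonalProfile p n).eval 1)⁻¹ • zonalPoly n (Pi.single 0 1 : Fin p → ℝ)) := by
  refine ⟨Submodule.smul_mem _ _ (zonalPoly_mem (sum_single_sq p)), ?_, fun R hR hRe x => ?_⟩
  · rw [smul_eval, eval_zonalPoly_of_sphere n _ (sum_single_sq p), sum_single_mul]
    simpa using inv_mul_cancel₀ (zonalProfile_eval_one_ne_zero h)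
  · have h0 : R.mulVec x 0 = x 0 := by
      have := dotProduct_mulVec_mulVec hR (Pi.single 0 1) x
      rwa [hRe, single_one_dotProduct, single_one_dotProduct] at this
    have h1 : ∑ i, R.mulVec x i ^ 2 = ∑ i, x i ^ 2 := by
      have := dotProduct_mulVec_mulVec hR x x
      simpa only [dotProduct, ← pow_two] using this
    rw [smul_eval, smul_eval, eval_zonalPoly, eval_zonalPoly, sum_single_mul, sum_single_mul, h0,
      h1]

lemma exists_isLegendrePolynomial {p n : ℕ} [NeZero p] (h : harmonicHomogeneous p n ≠ ⊥) :
    ∃ P, IsLegendrePolynomial p n P := by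
  refine ⟨((zonalProfile p n).eval 1)⁻¹ • zonalProfile p n, _, isZonalHarmonic_zonalPoly h,
    fun ξ => ?_⟩
  rw [smul_eval, eval_zonalPoly_of_sphere n _ (coe_sphere_sum_sq ξ), inner_eq_sum_mul,
    Polynomial.eval_smul, smul_eq_mul]
  rfl

/-! ### Uniqueness of the zonal harmonic -/

/-- If a homogeneous polynomial is a function of `ξ_0` on the unit sphere, its values depend only on
`x_0` and `|x|`. -/
lemma eval_eq_eval_of_sphere {p n : ℕ} [NeZero p] {L : MvPolynomial (Fin p) ℝ}
    (hL : L.IsHomogeneous n) {P : Polynomial ℝ}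
    (hP : ∀ x : Fin p → ℝ, ∑ i, x i ^ 2 = 1 → eval x L = P.eval (x 0))
    {x y : Fin p → ℝ} (hx : x ≠ 0) (hy : y ≠ 0) (h0 : x 0 = y 0)
    (h : ∑ i, x i ^ 2 = ∑ i, y i ^ 2) : eval x L = eval y L := by
  obtain ⟨hs, h1⟩ := sum_sq_smul_inv_sqrt hx
  obtain ⟨-, h2⟩ := sum_sq_smul_inv_sqrt hy
  have h3 := (hP _ h1).trans ((by simp [h0, h] : _ = _).trans (hP _ h2).symm)
  rw [← h, eval_smul_of_isHomogeneous hL, eval_smul_of_isHomogeneous hL] at h3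
  exact mul_left_cancel₀ (pow_ne_zero _ (inv_pos.2 hs).ne') h3

lemma sum_range_two_mul (f : ℕ → ℝ) (m : ℕ) :
    ∑ i ∈ Finset.range (2 * m), f i = ∑ k ∈ Finset.range m, (f (2 * k) + f (2 * k + 1)) := by
  induction m with
  | zero => simp
  | succ m ih => rw [mul_add, mul_one, Finset.sum_range_succ, Finset.sum_range_succ, ih,
      Finset.sum_range_succ, add_assoc]

lemma eval_eq_sum_of_even {n : ℕ} {g : Polynomial ℝ} (hn : g.natDegree ≤ n)
    (hg : ∀ r, g.eval (-r) = g.eval r) (r : ℝ) :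
    g.eval r = ∑ k ∈ Finset.range (n / 2 + 1), g.coeff (2 * k) * (r ^ 2) ^ k := by
  have hlt : g.natDegree < 2 * (n / 2 + 1) := by omega
  have h1 := hg r
  rw [Polynomial.eval_eq_sum_range' hlt, Polynomial.eval_eq_sum_range' hlt, sum_range_two_mul,
    sum_range_two_mul] at h1
  rw [Polynomial.eval_eq_sum_range' hlt, sum_range_two_mul]
  simp only [Finset.sum_add_distrib] at h1 ⊢
  have h2 : ∀ k, (-r) ^ (2 * k) = r ^ (2 * k) := fun k => (even_two_mul k).neg_pow r
  have h3 : ∀ k, (-r) ^ (2 * k + 1) = -r ^ (2 * k + 1) := fun k => (odd_two_mul_add_one k).neg_pow r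
  simp only [h2, h3, mul_neg, Finset.sum_neg_distrib] at h1
  simp only [pow_mul] at h1 ⊢
  linarith

/-- In dimension at least two, a homogeneous polynomial which is a function of `ξ_0` on the unit
sphere is a polynomial in `x_0` and `|x|² - x_0²`. -/
lemma exists_eq_sum_of_sphere {p n : ℕ} [NeZero p] {L : MvPolynomial (Fin p) ℝ}
    (hL : L.IsHomogeneous n) {P : Polynomial ℝ}
    (hP : ∀ x : Fin p → ℝ, ∑ i, x i ^ 2 = 1 → eval x L = P.eval (x 0))
    {j : Fin p} (hj : j ≠ 0) :
    ∃ b : ℕ → ℝ, L = ∑ k ∈ Finset.range (n / 2 + 1),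
      C (b k) * (X 0 ^ (n - 2 * k) * (normSqPoly p - X 0 ^ 2) ^ k) := by
  -- `pt r` is the point `e_0 + r e_j`, and `g` is the restriction of `L` to this line
  let pt : ℝ → Fin p → ℝ := fun r i => if i = 0 then 1 else if i = j then r else 0
  let f : Fin p → Polynomial ℝ := fun i => if i = 0 then 1 else if i = j then Polynomial.X else 0
  let g : Polynomial ℝ := aeval f L
  have hpt0 : ∀ r, pt r 0 = 1 := fun r => if_pos rfl
  have hpt : ∀ r, pt r ≠ 0 := fun r h => one_ne_zero ((hpt0 r).symm.trans (congrFun h 0))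
  have hptsq : ∀ r, ∑ i, pt r i ^ 2 = 1 + r ^ 2 := by
    intro r
    rw [← Finset.add_sum_erase _ _ (Finset.mem_univ 0), hpt0,
      Finset.sum_eq_single_of_mem j (Finset.mem_erase.2 ⟨hj, Finset.mem_univ j⟩)]
    · simp [pt, hj]
    · intro i hi hij
      simp [pt, Finset.ne_of_mem_erase hi, hij]
  have hg : ∀ r, g.eval r = eval (pt r) L := by
    intro r
    have h1 : (Polynomial.aeval r) (aeval f L) = aeval (fun i => Polynomial.aeval r (f i)) L :=
      comp_aeval_apply _ _ _
    rw [Polynomial.coe_aeval_eq_eval] at h1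
    refine h1.trans ((RingHom.congr_fun (coe_aeval_eq_eval _) L).trans ?_)
    congr 2
    funext i
    simp only [f, pt]
    split_ifs <;> simp
  have hdeg : g.natDegree ≤ n := by
    have := aeval_natDegree_le L hL.totalDegree_le f (n := 1) fun i => by
      simp only [f]
      split_ifs <;> simp
    rwa [mul_one] at this
  have heven : ∀ r, g.eval (-r) = g.eval r := by
    intro r
    rw [hg, hg]
    exact eval_eq_eval_of_sphere hL hP (hpt _) (hpt _) (by rw [hpt0, hpt0])
      (by rw [hptsq, hptsq, neg_sq])
  refine ⟨fun k => g.coeff (2 * k), ?_⟩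
  -- it suffices to compare values where `x_0 ≠ 0`
  refine mul_left_cancel₀ (X_ne_zero (R := ℝ) (0 : Fin p)) (MvPolynomial.funext fun x => ?_)
  rw [map_mul, map_mul, eval_X]
  rcases eq_or_ne (x 0) 0 with h0 | h0
  · rw [h0, zero_mul, zero_mul]
  congr 1
  have hle : 0 ≤ ∑ i, x i ^ 2 - x 0 ^ 2 := sub_nonneg.2
    (Finset.single_le_sum (f := fun i => x i ^ 2) (fun i _ => sq_nonneg _) (Finset.mem_univ 0))
  set t := √(∑ i, x i ^ 2 - x 0 ^ 2) / x 0 with ht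
  have ht2 : t ^ 2 = (∑ i, x i ^ 2 - x 0 ^ 2) / x 0 ^ 2 := by
    rw [ht, div_pow, Real.sq_sqrt hle]
  have hy0 : ((x 0)⁻¹ • x) 0 = 1 := by simp [h0]
  have h1 : eval ((x 0)⁻¹ • x) L = eval (pt t) L := by
    refine eval_eq_eval_of_sphere hL hP
      (fun h => one_ne_zero (hy0.symm.trans (congrFun h 0))) (hpt t) (by rw [hy0, hpt0]) ?_
    rw [hptsq, ht2]
    simp only [Pi.smul_apply, smul_eq_mul, mul_pow, ← Finset.mul_sum]
    field_simp
    ring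
  rw [eval_smul_of_isHomogeneous hL, ← hg, eval_eq_sum_of_even hdeg heven, ht2] at h1
  have h2 : eval x L = x 0 ^ n * ∑ k ∈ Finset.range (n / 2 + 1),
      g.coeff (2 * k) * ((∑ i, x i ^ 2 - x 0 ^ 2) / x 0 ^ 2) ^ k := by
    rw [← h1, inv_pow, mul_inv_cancel_left₀ (pow_ne_zero _ h0)]
  rw [h2, map_sum, Finset.mul_sum]
  refine Finset.sum_congr rfl fun k hk => ?_
  rw [Finset.mem_range] at hk
  have hn : x 0 ^ n = x 0 ^ (n - 2 * k) * (x 0 ^ 2) ^ k := by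
    rw [← pow_mul, ← pow_add]
    congr 1
    omega
  simp only [map_mul, eval_C, map_pow, map_sub, eval_X, eval_normSqPoly]
  rw [hn, div_pow]
  field_simp

lemma exists_normSqPoly_dvd_sub {p n : ℕ} [NeZero p] {L : MvPolynomial (Fin p) ℝ}
    (hL : L.IsHomogeneous n) {P : Polynomial ℝ}
    (hP : ∀ x : Fin p → ℝ, ∑ i, x i ^ 2 = 1 → eval x L = P.eval (x 0)) :
    ∃ β : ℝ, normSqPoly p ∣ L - C β * X 0 ^ n := by
  by_cases hp : ∃ j : Fin p, j ≠ 0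
  · obtain ⟨j, hj⟩ := hp
    obtain ⟨b, hb⟩ := exists_eq_sum_of_sphere hL hP hj
    refine ⟨∑ k ∈ Finset.range (n / 2 + 1), b k * (-1) ^ k, ?_⟩
    rw [hb, map_sum, Finset.sum_mul, ← Finset.sum_sub_distrib]
    refine Finset.dvd_sum fun k hk => ?_
    rw [Finset.mem_range] at hk
    have hn : (X 0 : MvPolynomial (Fin p) ℝ) ^ n = X 0 ^ (n - 2 * k) * (X 0 ^ 2) ^ k := by
      rw [← pow_mul, ← pow_add]
      congr 1
      omega
    have h1 := sub_dvd_pow_sub_pow (normSqPoly p - X 0 ^ 2) (-X 0 ^ 2) k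
    rw [sub_neg_eq_add, sub_add_cancel] at h1
    have h2 : C (b k) * (X 0 ^ (n - 2 * k) * (normSqPoly p - X 0 ^ 2) ^ k)
        - C (b k * (-1) ^ k) * X 0 ^ n =
        C (b k) * X 0 ^ (n - 2 * k) * ((normSqPoly p - X 0 ^ 2) ^ k - (-X 0 ^ 2) ^ k) := by
      rw [hn, neg_pow (X 0 ^ 2 : MvPolynomial (Fin p) ℝ) k, C_mul, C_pow, C_neg, C_1]
      ring
    rw [h2]
    exact h1.mul_left _
  -- in dimension one, every homogeneous polynomial is a multiple of `x_0 ^ n`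
  · push Not at hp
    refine ⟨eval (Pi.single 0 1) L, ?_⟩
    have h0 : L - C (eval (Pi.single 0 1) L) * X 0 ^ n = 0 := by
      refine MvPolynomial.funext fun x => ?_
      have hx : x = x 0 • (Pi.single 0 1 : Fin p → ℝ) := by
        funext i
        rw [hp i]
        simp
      have h1 := eval_smul_of_isHomogeneous hL (x 0) (Pi.single 0 1)
      rw [← hx] at h1
      simp [h1]
      ring
    rw [h0]
    exact dvd_zero _

/-- A harmonic homogeneous polynomial which is a function of `ξ_0` on the unit sphere is a multiple
of the zonal polynomial: it is congruent to one modulo `|x|²`, and a harmonic multiple of `|x|²` is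
orthogonal to itself. -/
lemma exists_eq_smul_zonalPoly {p n : ℕ} [NeZero p] {L : MvPolynomial (Fin p) ℝ}
    (hL : L ∈ harmonicHomogeneous p n) {P : Polynomial ℝ}
    (hP : ∀ x : Fin p → ℝ, ∑ i, x i ^ 2 = 1 → eval x L = P.eval (x 0)) :
    ∃ β : ℝ, L = β • zonalPoly n (Pi.single 0 1 : Fin p → ℝ) := by
  obtain ⟨β, hβ⟩ := exists_normSqPoly_dvd_sub hL.1 hP
  refine ⟨β, sub_eq_zero.1 (eq_zero_of_fischer_self (fischer_eq_zero_of_normSqPoly_dvd ?_ ?_))⟩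
  · have h1 := normSqPoly_dvd_zonalPoly_sub n (Pi.single 0 1 : Fin p → ℝ)
    have h2 : linForm (Pi.single 0 1 : Fin p → ℝ) = X 0 := by
      simp [linForm, Pi.single_apply, apply_ite C]
    rw [h2] at h1
    have h3 : L - β • zonalPoly n (Pi.single 0 1 : Fin p → ℝ) = L - C β * X 0 ^ n
        - C β * (zonalPoly n (Pi.single 0 1 : Fin p → ℝ) - X 0 ^ n) := by
      rw [smul_eq_C_mul]
      ring
    rw [h3]
    exact dvd_sub hβ (h1.mul_left _)
  · exact ((harmonicHomogeneous p n).sub_mem hL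
      (Submodule.smul_mem _ β (zonalPoly_mem (sum_single_sq p)))).2

/-! ### Expansion of spherical harmonics -/

/-- A unit vector `ξ'` whose angle with `(1, 0, …, 0)` is the angle between `ξ` and `η`. -/
lemma exists_sphere_inner_single_eq {p : ℕ} [NeZero p] (ξ η : UnitSphere p) :
    ∃ ξ' : UnitSphere p, inner ℝ (ξ' : EuclideanSpace ℝ (Fin p)) (EuclideanSpace.single 0 1) =
      inner ℝ (ξ : EuclideanSpace ℝ (Fin p)) (η : EuclideanSpace ℝ (Fin p)) := by
  have hη : ‖(η : EuclideanSpace ℝ (Fin p))‖ = ‖EuclideanSpace.single (0 : Fin p) (1 : ℝ)‖ := by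
    simp
  set e : EuclideanSpace ℝ (Fin p) := EuclideanSpace.single 0 1
  let T := Submodule.reflection (Submodule.span ℝ {(η : EuclideanSpace ℝ (Fin p)) - e})ᗮ
  have hT : T η = e := Submodule.reflection_sub hη
  refine ⟨⟨T ξ, by simp⟩, ?_⟩
  rw [← hT]
  exact T.inner_map_map _ _

/-- The Legendre polynomial represents a fixed non-zero multiple of the zonal polynomials. -/
lemma exists_legendrePolynomial_eval {p n : ℕ} [NeZero p] (h : harmonicHomogeneous p n ≠ ⊥) :
    ∃ β : ℝ, β ≠ 0 ∧ ∀ ξ η : UnitSphere p,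
      (legendrePolynomial p n).eval
          (inner ℝ (ξ : EuclideanSpace ℝ (Fin p)) (η : EuclideanSpace ℝ (Fin p))) =
        β * eval (ξ : EuclideanSpace ℝ (Fin p)).ofLp
          (zonalPoly n (η : EuclideanSpace ℝ (Fin p)).ofLp) := by
  have hex := exists_isLegendrePolynomial h
  have hspec : IsLegendrePolynomial p n (legendrePolynomial p n) := by
    rw [legendrePolynomial, dif_pos hex]
    exact hex.choose_spec
  obtain ⟨L, ⟨hL, hL1, -⟩, hLP⟩ := hspec
  have hinner : ∀ ξ : EuclideanSpace ℝ (Fin p),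
      inner ℝ ξ (EuclideanSpace.single 0 1) = ξ.ofLp 0 := fun ξ => by
    rw [inner_eq_sum_mul]
    exact sum_single_mul _
  obtain ⟨β, hβ⟩ := exists_eq_smul_zonalPoly (P := legendrePolynomial p n) hL (by
    intro x hx
    have := hLP ⟨WithLp.toLp 2 x, by
      rw [mem_sphere_zero_iff_norm, EuclideanSpace.norm_eq]
      simp [hx]⟩
    rwa [hinner] at this)
  refine ⟨β, ?_, fun ξ η => ?_⟩
  · rintro rfl
    rw [hβ, zero_smul, map_zero] at hL1
    exact zero_ne_one hL1
  · obtain ⟨ξ', hξ'⟩ := exists_sphere_inner_single_eq ξ η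
    rw [← hξ', ← hLP ξ', hβ, smul_eval, eval_zonalPoly_of_sphere n _ (coe_sphere_sum_sq ξ'),
      eval_zonalPoly_of_sphere n _ (coe_sphere_sum_sq ξ), sum_single_mul, ← inner_eq_sum_mul,
      ← hξ', hinner]

theorem mainTheorem5 (p n : ℕ) [NeZero p] (Y : UnitSphere p → ℝ)
    (hY : IsSphericalHarmonic p n Y) :
    ∃ (a : Fin (numHarmonic p n) → ℝ) (η : Fin (numHarmonic p n) → UnitSphere p),
      ∀ ξ : UnitSphere p,
        Y ξ = ∑ k, a k * (legendrePolynomial p n).eval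
          (inner ℝ (ξ : EuclideanSpace ℝ (Fin p)) (η k : EuclideanSpace ℝ (Fin p))) := by
  obtain ⟨H, hH, hYH⟩ := hY
  by_cases hbot : harmonicHomogeneous p n = ⊥
  · have hN : numHarmonic p n = 0 := by rw [numHarmonic, hbot, finrank_bot]
    have : IsEmpty (Fin (numHarmonic p n)) := by rw [hN]; infer_instance
    refine ⟨isEmptyElim, isEmptyElim, fun ξ => ?_⟩
    rw [hbot, Submodule.mem_bot] at hH
    rw [hYH, hH, map_zero, Finset.univ_eq_empty, Finset.sum_empty]
  · obtain ⟨β, hβ, hleg⟩ := exists_legendrePolynomial_eval hbot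
    have : Module.Finite ℝ (Submodule.span ℝ
        {Q | ∃ η : Fin p → ℝ, ∑ i, η i ^ 2 = 1 ∧ zonalPoly n η = Q}) := by
      rw [span_zonalPoly]
      infer_instance
    have hbasis := Submodule.exists_fun_fin_finrank_span_eq ℝ
      {Q | ∃ η : Fin p → ℝ, ∑ i, η i ^ 2 = 1 ∧ zonalPoly n η = Q}
    rw [span_zonalPoly] at hbasis
    obtain ⟨f, hf, hspan, -⟩ := hbasis
    choose η hη hfη using hf
    rw [← hspan, Submodule.mem_span_range_iff_exists_fun] at hH
    obtain ⟨c, hc⟩ := hH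
    refine ⟨fun k => c k / β, fun k => ⟨WithLp.toLp 2 (η k), by
      rw [mem_sphere_zero_iff_norm, EuclideanSpace.norm_eq]
      simpa using hη k⟩, fun ξ => ?_⟩
    rw [hYH, ← hc, map_sum]
    refine Finset.sum_congr rfl fun k _ => ?_
    rw [smul_eval, hleg, ← hfη]
    field_simp
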